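/- Let $F$ be a finite 4-regular graph, not necessarily connected, in which loops and parallel edges are allowed. Each edge consists of two half-edges, and every vertex is incident with exactly four half-edges. A circuit is a closed walk of positive length that traverses no edge twice, considered up to the choice of starting point and orientation. A circuit partition of $F$ is a set of circuits such that every edge of $F$ lies on exactly one of them; an Euler system of $F$ is a set of circuits that consists of exactly one Euler circuit of each connected component of $F$. A circuit partition $P$ determines at each vertex $v$ a transition, namely the pairing of the four half-edges at $v$ along which the circuits of $P$ pass through $v$. With respect to an Euler system $C$, whose circuits are given arbitrary orientations, the three transitions at $v$ are labelled as follows: $\phi$ is the transition of $C$ at $v$; $\chi$ is the other transition that pairs each half-edge directed into $v$ with one directed out of $v$; and $\psi$ is the remaining one. The interlacement graph $\mathcal I(C)$ is the simple graph with vertex set $V(F)$ in which two distinct vertices $v,w$ are adjacent if and only if they appear in the cyclic order $v\ldots w\ldots v\ldots w\ldots$ on a circuit of $C$. The modified interlacement matrix $M(C,P)$ is the $V(F)\times V(F)$ matrix over $GF(2)$ obtained from the adjacency matrix of $\mathcal I(C)$ by making the following changes for each vertex $v$: if $P$ involves the $\phi$ transition at $v$ with respect to $C$, then the diagonal entry of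 column $v$ becomes $1$ and all other entries of column $v$ become $0$; if $P$ involves the $\psi$ transition at $v$ with respect to $C$, then the diagonal entry of column $v$ becomes $1$. Suppose $C$ and $C'$ are two Euler systems of $F$. Then $M(C',C)$ is nonsingular, and for every circuit partition $P$ of $F$, $$M(C',P)=M(C',C)\cdot M(C,P).$$ -/

import Mathlib

/-- A multigraph with vertex set `V` and edge set `E`; loops and parallel edges are allowed.
The two half-edges of the edge `e` are `(e, false)` and `(e, true)`, and `vert h` is the vertex
on which the half-edge `h` is incident. -/
structure HalfEdgeGraph (V E : Type*) where
  vert : E × Bool → V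

namespace HalfEdgeGraph

variable {V E : Type*}

/-- The other half of the same edge. -/
def flip (h : E × Bool) : E × Bool := (h.1, !h.2)

/-- Every vertex is incident with exactly four half-edges. -/
def IsFourRegular (F : HalfEdgeGraph V E) : Prop :=
  ∀ v : V, {h : E × Bool | F.vert h = v}.ncard = 4

/-- Incidence of a vertex with an edge, as a relation on the disjoint union of `V` and `E`. -/
def Incident (F : HalfEdgeGraph V E) : V ⊕ E → V ⊕ E → Prop
  | .inl v, .inr e => ∃ b, F.vert (e, b) = v
  | _, _ => False

/-- Connected components: the classes of the equivalence relation on `V ⊕ E` that incidence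
generates. -/
def Component (F : HalfEdgeGraph V E) := Quot F.Incident

/-- The connected component that contains the edge `e`. -/
def edgeComponent (F : HalfEdgeGraph V E) (e : E) : F.Component :=
  Quot.mk _ (.inr e)

/-- A circuit `v₀, h₀, h₀', v₁, h₁, h₁', …, vₙ, hₙ, hₙ', v₀` with `n + 1` pairwise distinct edges.
It is given by its initial half-edges `hᵢ = half i`; then `hᵢ' = flip (half i)` and
`vᵢ = vert (half i)`. Addition in `Fin (n + 1)` is cyclic, so `step` includes the closing step. -/
structure Circuit (F : HalfEdgeGraph V E) where
  n : ℕ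
  half : Fin (n + 1) → E × Bool
  step : ∀ i, F.vert (flip (half i)) = F.vert (half (i + 1))
  edges_distinct : Function.Injective fun i => (half i).1

/-- The circuit traverses the edge `e`. -/
def Circuit.Uses {F : HalfEdgeGraph V E} (γ : F.Circuit) (e : E) : Prop :=
  ∃ i, (γ.half i).1 = e

/-- `γ` is an Euler circuit of the component `K`: its edges are exactly the edges of `K`
(and no circuit traverses an edge twice). -/
def Circuit.IsEulerCircuitOf {F : HalfEdgeGraph V E} (γ : F.Circuit) (K : F.Component) : Prop :=
  ∀ e, γ.Uses e ↔ F.edgeComponent e = K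

/-- A circuit partition: each edge is traversed by exactly one circuit of the collection. -/
def IsCircuitPartition (F : HalfEdgeGraph V E) (P : Set F.Circuit) : Prop :=
  ∀ e, ∃! γ, γ ∈ P ∧ γ.Uses e

/-- An Euler system: a collection of Euler circuits, exactly one in each connected component. -/
def IsEulerSystem (F : HalfEdgeGraph V E) (C : Set F.Circuit) : Prop :=
  (∀ γ ∈ C, ∃ K, γ.IsEulerCircuitOf K) ∧ ∀ K, ∃! γ, γ ∈ C ∧ γ.IsEulerCircuitOf K

theorem IsEulerSystem.isCircuitPartition {F : HalfEdgeGraph V E} {C : Set F.Circuit}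
    (hC : F.IsEulerSystem C) : F.IsCircuitPartition C := by
  intro e
  obtain ⟨γ, ⟨hγC, hγ⟩, huniq⟩ := hC.2 (F.edgeComponent e)
  refine ⟨γ, ⟨hγC, (hγ e).2 rfl⟩, ?_⟩
  rintro δ ⟨hδC, hδe⟩
  obtain ⟨K, hK⟩ := hC.1 δ hδC
  have h := (hK e).1 hδe
  subst h
  exact huniq δ ⟨hδC, hK⟩

/-- The transition of the circuit partition `P` at `v`: the set of the (unordered) pairs of
half-edges along which the circuits of `P` pass through `v`. -/
def transition (F : HalfEdgeGraph V E) (P : Set F.Circuit) (v : V) : Set (Sym2 (E × Bool)) :=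
  {p | ∃ γ ∈ P, ∃ i, F.vert (γ.half (i + 1)) = v ∧ p = s(flip (γ.half i), γ.half (i + 1))}

/-- The half-edge `h` points out of its vertex in the orientation in which the circuits of `C`
are listed. -/
def IsOutgoing (F : HalfEdgeGraph V E) (C : Set F.Circuit) (h : E × Bool) : Prop :=
  ∃ γ ∈ C, ∃ i, h = γ.half i

/-- The half-edge `h` points into its vertex in the orientation in which the circuits of `C`
are listed. -/
def IsIncoming (F : HalfEdgeGraph V E) (C : Set F.Circuit) (h : E × Bool) : Prop :=
  ∃ γ ∈ C, ∃ i, h = flip (γ.half i)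

/-- A transition `T` is consistent with the orientation of `C` if each of its pairs consists of an
incoming and an outgoing half-edge. -/
def IsConsistent (F : HalfEdgeGraph V E) (C : Set F.Circuit) (T : Set (Sym2 (E × Bool))) : Prop :=
  ∀ p ∈ T, ∃ a b, p = s(a, b) ∧ F.IsIncoming C a ∧ F.IsOutgoing C b

/-- `P` involves the `φ` transition with respect to `C` at `v`: the one that appears in `C`. -/
def InvolvesPhi (F : HalfEdgeGraph V E) (C P : Set F.Circuit) (v : V) : Prop :=
  F.transition P v = F.transition C v

/-- `P` involves the `χ` transition with respect to `C` at `v`: not the one of `C`, but consistent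
with the orientation of the incident circuit of `C`. -/
def InvolvesChi (F : HalfEdgeGraph V E) (C P : Set F.Circuit) (v : V) : Prop :=
  F.transition P v ≠ F.transition C v ∧ F.IsConsistent C (F.transition P v)

/-- `P` involves the `ψ` transition with respect to `C` at `v`: not the one of `C`, and not
consistent with the orientation of the incident circuit of `C`. -/
def InvolvesPsi (F : HalfEdgeGraph V E) (C P : Set F.Circuit) (v : V) : Prop :=
  F.transition P v ≠ F.transition C v ∧ ¬ F.IsConsistent C (F.transition P v)

/-- The positions `i < j < k < l` of `γ` visit `v, w, v, w`, in this order. -/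
def Circuit.Alternates {F : HalfEdgeGraph V E} (γ : F.Circuit) (v w : V) : Prop :=
  ∃ i j k l, i < j ∧ j < k ∧ k < l ∧ F.vert (γ.half i) = v ∧ F.vert (γ.half j) = w ∧
    F.vert (γ.half k) = v ∧ F.vert (γ.half l) = w

/-- The interlacement graph of `C`: distinct vertices are adjacent if they appear in the cyclic
order `v … w … v … w …` on a circuit of `C`. (A circuit is listed from some starting point, whence
the two cases.) -/
def interlacementGraph (F : HalfEdgeGraph V E) (C : Set F.Circuit) : SimpleGraph V where
  Adj v w := v ≠ w ∧ ∃ γ ∈ C, γ.Alternates v w ∨ γ.Alternates w v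
  symm := ⟨fun _ _ ⟨hne, γ, hγ, h⟩ => ⟨hne.symm, γ, hγ, h.symm⟩⟩
  loopless := ⟨fun _ h => h.1 rfl⟩

open Classical in
/-- The modified interlacement matrix `M(C, P)` over `GF(2)`, with entry in row `w` and
column `v`. -/
noncomputable def modifiedInterlacement (F : HalfEdgeGraph V E) (C P : Set F.Circuit) :
    Matrix V V (ZMod 2) :=
  Matrix.of fun w v =>
    if F.InvolvesPhi C P v then (if w = v then 1 else 0)
    else if F.InvolvesPsi C P v ∧ w = v then 1
    else (F.interlacementGraph C).adjMatrix (ZMod 2) w v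

end HalfEdgeGraph

/-! The matrices are change-of-coordinates matrices on the cycle space of $F$ over $GF(2)$. For a
cycle `z` and a circuit partition $P$, let `crossing P z` be the vector whose entry at $v$ is the
sum of `z` over either pair of the transition of $P$ at $v$; both pairs give the same sum because
`z` sums to zero at $v$.

If $C$ is an Euler system, then `crossing P z` is the row vector `crossing C z` times $M(C,P)$
(`crossing_eq_vecMul`). At a $\phi$ vertex this is immediate. At a $\chi$ vertex the sum over a pair
telescopes along the circuit segment between the two visits, and the vertices met an odd number of
times there are the interlaced ones (`cast_card_visits_between`). A $\psi$ sum is the sum of the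
other two.

Moreover, every unit vector is `crossing C' z` for some cycle `z` (`exists_dual_cycle`). Evaluating
`crossing P z` through $C'$ directly, and through $C'$ then $C$, gives the product formula row by
row. Taking $P=C'$ gives $M(C',C)M(C,C')=M(C',C')=1$. -/

namespace HalfEdgeGraph

variable {V E : Type*} {F : HalfEdgeGraph V E}

/-! ### Half-edges and passages of circuits through a vertex -/

theorem flip_ne (h : E × Bool) : flip h ≠ h := by
  intro he
  have := congrArg Prod.snd he
  simp [flip] at this

theorem eq_or_eq_flip_of_fst_eq {h k : E × Bool} (e : h.1 = k.1) : h = k ∨ h = flip k := by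
  obtain ⟨a, b⟩ := h
  obtain ⟨c, d⟩ := k
  cases b <;> cases d <;> simp_all [flip]

/-- A position on some circuit of `F`. -/
abbrev Position (F : HalfEdgeGraph V E) := Σ γ : F.Circuit, Fin (γ.n + 1)

/-- The half-edge along which a circuit arrives at a position. -/
def Position.inHalf (x : F.Position) : E × Bool := flip (x.1.half (x.2 - 1))

/-- The half-edge along which a circuit leaves a position. -/
def Position.outHalf (x : F.Position) : E × Bool := x.1.half x.2

theorem Position.vert_inHalf (x : F.Position) : F.vert x.inHalf = F.vert x.outHalf := by
  have h := x.1.step (x.2 - 1)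
  rw [sub_add_cancel] at h
  exact h

/-- The positions at which the circuits of `P` visit `v`. -/
def passages (F : HalfEdgeGraph V E) (P : Set F.Circuit) (v : V) : Set F.Position :=
  {x | x.1 ∈ P ∧ F.vert x.outHalf = v}

theorem transition_eq_image (P : Set F.Circuit) (v : V) :
    F.transition P v = (fun x : F.Position => s(x.inHalf, x.outHalf)) '' F.passages P v := by
  ext p
  constructor
  · rintro ⟨γ, hγ, i, hi, rfl⟩
    refine ⟨⟨γ, i + 1⟩, ⟨hγ, hi⟩, ?_⟩
    simp [Position.inHalf, Position.outHalf]
  · rintro ⟨x, ⟨hx, hv⟩, rfl⟩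
    refine ⟨x.1, hx, x.2 - 1, ?_, ?_⟩
    · rw [sub_add_cancel]; exact hv
    · rw [sub_add_cancel]; rfl

section Partition

variable {P : Set F.Circuit}

theorem IsCircuitPartition.position_eq (hP : F.IsCircuitPartition P) {x y : F.Position}
    (hx : x.1 ∈ P) (hy : y.1 ∈ P) (h : x.outHalf.1 = y.outHalf.1) : x = y := by
  obtain ⟨γ, i⟩ := x
  obtain ⟨δ, j⟩ := y
  have := (hP (γ.half i).1).unique ⟨hx, i, rfl⟩ ⟨hy, j, h.symm⟩
  dsimp only at this
  subst this
  have hij : i = j := γ.edges_distinct h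
  rw [hij]

theorem IsCircuitPartition.outHalf_injOn (hP : F.IsCircuitPartition P) (v : V) :
    Set.InjOn Position.outHalf (F.passages P v) :=
  fun _ hx _ hy h => hP.position_eq hx.1 hy.1 (congrArg Prod.fst h)

theorem IsCircuitPartition.inHalf_injOn (hP : F.IsCircuitPartition P) (v : V) :
    Set.InjOn Position.inHalf (F.passages P v) := by
  rintro ⟨γ, i⟩ hx ⟨δ, j⟩ hy h
  have := hP.position_eq (x := ⟨γ, i - 1⟩) (y := ⟨δ, j - 1⟩) hx.1 hy.1
    (show (flip (γ.half (i - 1))).1 = (flip (δ.half (j - 1))).1 from congrArg Prod.fst h)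
  obtain ⟨rfl, h2⟩ := Sigma.mk.inj_iff.1 this
  rw [sub_left_injective (eq_of_heq h2)]

theorem IsCircuitPartition.not_incoming_of_outgoing (hP : F.IsCircuitPartition P)
    {h : E × Bool} (h1 : F.IsOutgoing P h) : ¬ F.IsIncoming P h := by
  rintro ⟨δ, hδ, j, rfl⟩
  obtain ⟨γ, hγ, i, hi⟩ := h1
  have := hP.position_eq (x := ⟨γ, i⟩) (y := ⟨δ, j⟩) hγ hδ (by
    show (γ.half i).1 = (δ.half j).1
    rw [← hi]; rfl)
  obtain ⟨rfl, h2⟩ := Sigma.mk.inj_iff.1 this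
  rw [eq_of_heq h2] at hi
  exact flip_ne _ hi

theorem Position.isOutgoing {x : F.Position} (hx : x.1 ∈ P) : F.IsOutgoing P x.outHalf :=
  ⟨x.1, hx, x.2, rfl⟩

theorem Position.isIncoming {x : F.Position} (hx : x.1 ∈ P) : F.IsIncoming P x.inHalf :=
  ⟨x.1, hx, x.2 - 1, rfl⟩

theorem IsCircuitPartition.inHalf_ne_outHalf (hP : F.IsCircuitPartition P) {x y : F.Position}
    (hx : x.1 ∈ P) (hy : y.1 ∈ P) : x.inHalf ≠ y.outHalf := fun h =>
  hP.not_incoming_of_outgoing (y.isOutgoing hy) (h ▸ x.isIncoming hx)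

theorem IsCircuitPartition.halfEdges_eq (hP : F.IsCircuitPartition P) (v : V) :
    {h | F.vert h = v} =
      Position.inHalf '' F.passages P v ∪ Position.outHalf '' F.passages P v := by
  ext h
  constructor
  · intro hv
    obtain ⟨γ, ⟨hγ, i, hi⟩, -⟩ := hP h.1
    rcases eq_or_eq_flip_of_fst_eq hi.symm with e | e
    · exact Or.inr ⟨⟨γ, i⟩, ⟨hγ, by rw [← hv, e]; rfl⟩, e.symm⟩
    · have e' : h = Position.inHalf (⟨γ, i + 1⟩ : F.Position) := by
        simp [Position.inHalf, e]
      exact Or.inl ⟨⟨γ, i + 1⟩, ⟨hγ, by rw [← Position.vert_inHalf, ← e']; exact hv⟩, e'.symm⟩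
  · rintro (⟨x, hx, rfl⟩ | ⟨x, hx, rfl⟩)
    · exact x.vert_inHalf.trans hx.2
    · exact hx.2

/-- The four half-edges split into arrivals and departures, and each passage accounts for one of
each. -/
theorem IsCircuitPartition.ncard_passages (hP : F.IsCircuitPartition P) (hF : F.IsFourRegular)
    (v : V) : (F.passages P v).ncard = 2 := by
  have h4 := hF v
  have hfin : {h : E × Bool | F.vert h = v}.Finite :=
    Set.finite_of_ncard_ne_zero (by rw [h4]; norm_num)
  rw [hP.halfEdges_eq v] at h4 hfin
  rw [Set.ncard_union_eq _ (hfin.subset Set.subset_union_left)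
    (hfin.subset Set.subset_union_right), (hP.inHalf_injOn v).ncard_image,
    (hP.outHalf_injOn v).ncard_image] at h4
  · omega
  · rw [Set.disjoint_left]
    rintro _ ⟨x, hx, rfl⟩ ⟨y, hy, h⟩
    exact hP.inHalf_ne_outHalf hx.1 hy.1 h.symm

theorem IsCircuitPartition.exists_matching (hP : F.IsCircuitPartition P)
    (hF : F.IsFourRegular) (v : V) :
    ∃ a b c d : E × Bool, [a, b, c, d].Nodup ∧ {h | F.vert h = v} = {a, b, c, d} ∧
      F.transition P v = {s(a, b), s(c, d)} := by
  obtain ⟨x, y, hxy, h⟩ := Set.ncard_eq_two.1 (hP.ncard_passages hF v)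
  have hx : x ∈ F.passages P v := by simp [h]
  have hy : y ∈ F.passages P v := by simp [h]
  refine ⟨x.inHalf, x.outHalf, y.inHalf, y.outHalf, ?_, ?_, ?_⟩
  · have h1 := hP.inHalf_ne_outHalf hx.1 hx.1
    have h2 := hP.inHalf_ne_outHalf hx.1 hy.1
    have h3 := hP.inHalf_ne_outHalf hy.1 hx.1
    have h4 := hP.inHalf_ne_outHalf hy.1 hy.1
    have h5 : x.inHalf ≠ y.inHalf := fun e => hxy (hP.inHalf_injOn v hx hy e)
    have h6 : x.outHalf ≠ y.outHalf := fun e => hxy (hP.outHalf_injOn v hx hy e)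
    simp [h1, h2, h3.symm, h4, h5, h6]
  · rw [hP.halfEdges_eq, h]
    ext h; simp; tauto
  · rw [transition_eq_image, h]; simp [Set.image_insert_eq]

end Partition

/-- Each of the two circuits is an Euler circuit of the component of `v`, and `C` has only one. -/
theorem IsEulerSystem.passages_same_circuit {C : Set F.Circuit} (hC : F.IsEulerSystem C) {v : V}
    {x y : F.Position} (hx : x ∈ F.passages C v) (hy : y ∈ F.passages C v) : x.1 = y.1 := by
  have key : ∀ z ∈ F.passages C v, z.1.IsEulerCircuitOf (Quot.mk _ (.inl v)) := by
    intro z hz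
    obtain ⟨K, hK⟩ := hC.1 z.1 hz.1
    have h1 : F.edgeComponent z.outHalf.1 = K := (hK _).1 ⟨z.2, rfl⟩
    have h2 : (Quot.mk F.Incident (.inl v) : F.Component) = F.edgeComponent z.outHalf.1 :=
      Quot.sound ⟨z.outHalf.2, hz.2⟩
    rw [h2, h1]
    exact hK
  exact (hC.2 _).unique ⟨hx.1, key x hx⟩ ⟨hy.1, key y hy⟩

theorem IsEulerSystem.exists_visits {C : Set F.Circuit} (hC : F.IsEulerSystem C)
    (hF : F.IsFourRegular) (v : V) : ∃ γ ∈ C, ∃ i j : Fin (γ.n + 1), i < j ∧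
      F.passages C v = {⟨γ, i⟩, ⟨γ, j⟩} := by
  obtain ⟨⟨γ, i⟩, ⟨δ, j⟩, hxy, h⟩ :=
    Set.ncard_eq_two.1 (hC.isCircuitPartition.ncard_passages hF v)
  have hx : (⟨γ, i⟩ : F.Position) ∈ F.passages C v := by simp [h]
  have hy : (⟨δ, j⟩ : F.Position) ∈ F.passages C v := by simp [h]
  have e : γ = δ := hC.passages_same_circuit hx hy
  subst e
  have hij : i ≠ j := fun e => hxy (by rw [e])
  rcases lt_or_gt_of_ne hij with hlt | hlt
  · exact ⟨γ, hx.1, i, j, hlt, h⟩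
  · exact ⟨γ, hx.1, j, i, hlt, by rw [h, Set.pair_comm]⟩

/-! ### Cycle space and crossing vectors -/

/-- A function on the edges that belongs to the cycle space over `GF(2)`. -/
def IsCycle (F : HalfEdgeGraph V E) (z : E → ZMod 2) : Prop :=
  ∀ v, ∑ᶠ h ∈ {h | F.vert h = v}, z h.1 = 0

theorem sum_halfEdges {z : E → ZMod 2} {v : V} {a b c d : E × Bool}
    (hd : [a, b, c, d].Nodup) (h : {h | F.vert h = v} = {a, b, c, d}) :
    ∑ᶠ h ∈ {h | F.vert h = v}, z h.1 = z a.1 + (z b.1 + (z c.1 + z d.1)) := by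
  simp only [List.nodup_cons, List.mem_cons, not_or] at hd
  rw [h, finsum_mem_insert _ (by simp; tauto) (Set.toFinite _),
    finsum_mem_insert _ (by simp; tauto) (Set.toFinite _), finsum_mem_pair (by tauto)]

open Classical in
/-- Whether the set of edges `z` separates the two half-edges in a pair of `P` at `v`. -/
noncomputable def crossing (F : HalfEdgeGraph V E) (P : Set F.Circuit) (z : E → ZMod 2) (v : V) :
    ZMod 2 :=
  if ∃ a b, s(a, b) ∈ F.transition P v ∧ z a.1 ≠ z b.1 then 1 else 0

theorem zmod_two_add_eq_ite (x y : ZMod 2) : x + y = if x ≠ y then 1 else 0 := by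
  revert x y; decide

theorem zmod_two_pair_eq {x y u w : ZMod 2} (h : x + (y + (u + w)) = 0) :
    x + y = u + w := by
  revert x y u w; decide

/-- The four values of `z` at `v` sum to zero, so both pairs of the transition have the same sum and
any pair computes the crossing. -/
theorem crossing_eq {P : Set F.Circuit} (hP : F.IsCircuitPartition P) (hF : F.IsFourRegular)
    {z : E → ZMod 2} (hz : F.IsCycle z) {v : V} {a b : E × Bool}
    (hab : s(a, b) ∈ F.transition P v) : F.crossing P z v = z a.1 + z b.1 := by
  obtain ⟨p, q, r, s, hd, hv, ht⟩ := hP.exists_matching hF v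
  have h := hz v
  rw [sum_halfEdges hd hv] at h
  have key : ∀ a b, s(a, b) ∈ F.transition P v → z a.1 + z b.1 = z p.1 + z q.1 := by
    intro a b hab
    rw [ht] at hab
    simp only [Set.mem_insert_iff, Set.mem_singleton_iff, Sym2.eq_iff] at hab
    rcases hab with (⟨rfl, rfl⟩ | ⟨rfl, rfl⟩) | (⟨rfl, rfl⟩ | ⟨rfl, rfl⟩)
    · rfl
    · exact add_comm _ _
    · exact (zmod_two_pair_eq h).symm
    · rw [add_comm]; exact (zmod_two_pair_eq h).symm
  rw [key a b hab, crossing, zmod_two_add_eq_ite]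
  congr 1
  apply propext
  constructor
  · rintro ⟨c, d, hcd, hne⟩ he
    have := key c d hcd
    rw [zmod_two_add_eq_ite, if_pos hne, zmod_two_add_eq_ite, if_neg (not_not.2 he)] at this
    exact one_ne_zero this
  · intro hne
    exact ⟨p, q, by simp [ht], hne⟩

theorem exists_matching_partner {α : Type*} {a p q r s : α} (hd : [p, q, r, s].Nodup)
    (ha : a ∈ ({p, q, r, s} : Set α)) : ∃ x y z, [a, x, y, z].Nodup ∧
      ({p, q, r, s} : Set α) = {a, x, y, z} ∧
      ({s(p, q), s(r, s)} : Set (Sym2 α)) = {s(a, x), s(y, z)} := by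
  simp only [List.nodup_cons, List.mem_cons, not_or] at hd
  rcases ha with rfl | rfl | rfl | rfl
  · exact ⟨q, r, s, by simp; tauto, rfl, rfl⟩
  · exact ⟨p, r, s, by simp; tauto, by ext; simp; tauto, by rw [Sym2.eq_swap]⟩
  · exact ⟨s, p, q, by simp; tauto, by ext; simp; tauto, Set.pair_comm _ _⟩
  · exact ⟨r, p, q, by simp; tauto, by ext; simp; tauto, by rw [Set.pair_comm, Sym2.eq_swap]⟩

/-- The partner of `a` decides the matching. With `a`, `c` incoming and `b`, `d` outgoing along two
passages, the cases are $\phi$, $\chi$, $\psi$ in this order. -/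
theorem matching_cases {α : Type*} {a b c d p q r s : α} (hd : [a, b, c, d].Nodup)
    (hd' : [p, q, r, s].Nodup) (h : ({a, b, c, d} : Set α) = {p, q, r, s}) :
    ({s(p, q), s(r, s)} : Set (Sym2 α)) = {s(a, b), s(c, d)} ∨
    ({s(p, q), s(r, s)} : Set (Sym2 α)) = {s(a, d), s(c, b)} ∨
    ({s(p, q), s(r, s)} : Set (Sym2 α)) = {s(a, c), s(b, d)} := by
  obtain ⟨x, y, z, hd2, h2, e⟩ := exists_matching_partner (a := a) hd' (by simp [← h])
  rw [e]
  rw [h2] at h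
  have hx : x ∈ ({a, b, c, d} : Set α) := by simp [h]
  have hy : y ∈ ({a, b, c, d} : Set α) := by simp [h]
  have hz : z ∈ ({a, b, c, d} : Set α) := by simp [h]
  clear h h2 e hd'
  simp only [List.nodup_cons, List.mem_cons, not_or] at hd hd2
  obtain ⟨⟨hax, hay, haz, -⟩, ⟨hxy, hxz, -⟩, ⟨hyz, -⟩, -⟩ := hd2
  replace hx := hx.resolve_left (Ne.symm hax)
  replace hy := hy.resolve_left (Ne.symm hay)
  replace hz := hz.resolve_left (Ne.symm haz)
  rcases hx with rfl | rfl | rfl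
  · left
    rcases hy with rfl | rfl | rfl <;> rcases hz with rfl | rfl | rfl <;>
      first | contradiction | rfl | rw [Sym2.eq_swap (a := y)]
  · right; right
    rcases hy with rfl | rfl | rfl <;> rcases hz with rfl | rfl | rfl <;>
      first | contradiction | rfl | rw [Sym2.eq_swap (a := y)]
  · right; left
    rcases hy with rfl | rfl | rfl <;> rcases hz with rfl | rfl | rfl <;>
      first | contradiction | rfl | rw [Sym2.eq_swap (a := y)]

theorem sum_Ioo_telescope {n : ℕ} (f : Fin (n + 1) → ZMod 2) {i j : Fin (n + 1)} (hij : i < j) :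
    ∑ k ∈ Finset.Ioo i j, (f (k - 1) + f k) = f i + f (j - 1) := by
  induction j using Fin.induction with
  | zero => exact absurd hij (Fin.not_lt_zero _)
  | succ j ih =>
    have e : j.succ - 1 = j.castSucc := by
      rw [← Fin.coeSucc_eq_succ, add_sub_cancel_right]
    rw [e]
    rcases (Fin.le_castSucc_iff.2 hij).eq_or_lt with h | h
    · have : Finset.Ioo i j.succ = ∅ := by
        ext k; simp only [h, Finset.mem_Ioo, Finset.notMem_empty, iff_false, Fin.lt_def,
          Fin.val_succ, Fin.val_castSucc]; omega
      rw [this, h, Finset.sum_empty, CharTwo.add_self_eq_zero]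
    · have : Finset.Ioo i j.succ = insert j.castSucc (Finset.Ioo i j.castSucc) := by
        ext k; simp only [Finset.mem_Ioo, Finset.mem_insert, Fin.ext_iff, Fin.lt_def,
          Fin.val_succ, Fin.val_castSucc] at h ⊢; omega
      rw [this, Finset.sum_insert (by simp), ih h]
      linear_combination CharTwo.add_self_eq_zero (f (j.castSucc - 1))

/-! ### Crossing vectors through an Euler system -/

section Euler

variable {C : Set F.Circuit}

/-- Of the two visits to `v`, exactly one falls strictly between the visits to `w` precisely when
the two vertices interlace; otherwise the count is 0 or 2. -/
theorem IsEulerSystem.cast_card_visits_between [DecidableEq V] (hC : F.IsEulerSystem C)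
    (hF : F.IsFourRegular) [DecidableRel (F.interlacementGraph C).Adj] {w : V} {γ : F.Circuit}
    (hγ : γ ∈ C) {i j : Fin (γ.n + 1)} (hij : i < j) (h : F.passages C w = {⟨γ, i⟩, ⟨γ, j⟩})
    (v : V) :
    (((Finset.Ioo i j).filter fun k => F.vert (γ.half k) = v).card : ZMod 2) =
      if (F.interlacementGraph C).Adj v w then 1 else 0 := by
  have hw : ∀ δ ∈ C, ∀ k, F.vert (δ.half k) = w →
      (⟨δ, k⟩ : F.Position) = ⟨γ, i⟩ ∨ (⟨δ, k⟩ : F.Position) = ⟨γ, j⟩ := by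
    intro δ hδ k hk
    have : (⟨δ, k⟩ : F.Position) ∈ F.passages C w := ⟨hδ, hk⟩
    rwa [h] at this
  have hwi : F.vert (γ.half i) = w := (h.symm ▸ Or.inl rfl : (⟨γ, i⟩ : F.Position) ∈ F.passages C w).2
  have hwj : F.vert (γ.half j) = w := (h.symm ▸ Or.inr rfl : (⟨γ, j⟩ : F.Position) ∈ F.passages C w).2
  have hwγ : ∀ k, F.vert (γ.half k) = w → k = i ∨ k = j := by
    intro k hk
    simpa using hw γ hγ k hk
  by_cases hvw : v = w
  · subst hvw
    rw [if_neg (SimpleGraph.irrefl _), Finset.filter_eq_empty_iff.2]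
    · simp
    · intro k hk hkv
      rw [Finset.mem_Ioo] at hk
      rcases hwγ k hkv with rfl | rfl
      · exact lt_irrefl _ hk.1
      · exact lt_irrefl _ hk.2
  obtain ⟨δ, hδ, p, q, hpq, h'⟩ := hC.exists_visits hF v
  have hvp : F.vert (δ.half p) = v := (h'.symm ▸ Or.inl rfl : (⟨δ, p⟩ : F.Position) ∈ F.passages C v).2
  have hvq : F.vert (δ.half q) = v := (h'.symm ▸ Or.inr rfl : (⟨δ, q⟩ : F.Position) ∈ F.passages C v).2
  have hv : ∀ ε ∈ C, ∀ k, F.vert (ε.half k) = v →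
      (⟨ε, k⟩ : F.Position) = ⟨δ, p⟩ ∨ (⟨ε, k⟩ : F.Position) = ⟨δ, q⟩ := by
    intro ε hε k hk
    have : (⟨ε, k⟩ : F.Position) ∈ F.passages C v := ⟨hε, hk⟩
    rwa [h'] at this
  have hcirc : ∀ ε ∈ C, ∀ k, F.vert (ε.half k) = v → ε = δ := by
    intro ε hε k hk
    rcases hv ε hε k hk with e | e <;> exact (Sigma.mk.inj_iff.1 e).1
  have hcirc' : ∀ ε ∈ C, ∀ k, F.vert (ε.half k) = w → ε = γ := by
    intro ε hε k hk
    rcases hw ε hε k hk with e | e <;> exact (Sigma.mk.inj_iff.1 e).1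
  by_cases hδγ : δ = γ
  · subst hδγ
    have hvδ : ∀ k, F.vert (δ.half k) = v ↔ k = p ∨ k = q := by
      intro k
      refine ⟨fun hk => by simpa using hv δ hδ k hk, ?_⟩
      rintro (rfl | rfl) <;> assumption
    have hip : i ≠ p := by rintro rfl; exact hvw (hvp.symm.trans hwi)
    have hiq : i ≠ q := by rintro rfl; exact hvw (hvq.symm.trans hwi)
    have hjp : j ≠ p := by rintro rfl; exact hvw (hvp.symm.trans hwj)
    have hjq : j ≠ q := by rintro rfl; exact hvw (hvq.symm.trans hwj)
    have hadj : (F.interlacementGraph C).Adj v w ↔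
        (p < i ∧ i < q ∧ q < j) ∨ (i < p ∧ p < j ∧ j < q) := by
      constructor
      · rintro ⟨-, ε, hε, ⟨a, b, c, d, hab, hbc, hcd, ha, hb, hc, hd⟩ |
          ⟨a, b, c, d, hab, hbc, hcd, ha, hb, hc, hd⟩⟩
        · obtain rfl := hcirc' ε hε b hb
          have h1 := (hvδ a).1 ha
          have h2 := hwγ b hb
          have h3 := (hvδ c).1 hc
          have h4 := hwγ d hd
          omega
        · obtain rfl := hcirc' ε hε a ha
          have h1 := hwγ a ha
          have h2 := (hvδ b).1 hb
          have h3 := hwγ c hc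
          have h4 := (hvδ d).1 hd
          omega
      · rintro (⟨h1, h2, h3⟩ | ⟨h1, h2, h3⟩)
        · exact ⟨hvw, δ, hδ, Or.inl ⟨p, i, q, j, h1, h2, h3, hvp, hwi, hvq, hwj⟩⟩
        · exact ⟨hvw, δ, hδ, Or.inr ⟨i, p, j, q, h1, h2, h3, hwi, hvp, hwj, hvq⟩⟩
    have hfilter : (Finset.Ioo i j).filter (fun k => F.vert (δ.half k) = v) =
        ({p, q} : Finset (Fin (δ.n + 1))).filter (fun k => i < k ∧ k < j) := by
      ext k
      simp only [Finset.mem_filter, Finset.mem_Ioo, hvδ, Finset.mem_insert,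
        Finset.mem_singleton]
      tauto
    rw [hfilter, Finset.filter_insert, Finset.filter_singleton]
    by_cases hp : i < p ∧ p < j <;> by_cases hq : i < q ∧ q < j
    · rw [if_pos hp, if_pos hq, if_neg (by rw [hadj]; omega),
        Finset.card_insert_of_notMem (by simpa using hpq.ne),
        Finset.card_singleton]
      rfl
    · rw [if_pos hp, if_neg hq, if_pos (by rw [hadj]; omega)]
      simp
    · rw [if_neg hp, if_pos hq, if_pos (by rw [hadj]; omega)]
      simp
    · rw [if_neg hp, if_neg hq, if_neg (by rw [hadj]; omega)]
      simp
  · rw [if_neg, Finset.filter_eq_empty_iff.2]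
    · simp
    · intro k _ hk
      exact hδγ (hcirc γ hγ k hk).symm
    · rintro ⟨-, ε, hε, ⟨a, b, c, d, hab, hbc, hcd, ha, hb, hc, hd⟩ |
        ⟨a, b, c, d, hab, hbc, hcd, ha, hb, hc, hd⟩⟩
      · exact hδγ ((hcirc ε hε a ha).symm.trans (hcirc' ε hε b hb))
      · exact hδγ ((hcirc ε hε b hb).symm.trans (hcirc' ε hε a ha))

theorem Position.crossing_eq (hC : F.IsCircuitPartition C) (hF : F.IsFourRegular)
    {z : E → ZMod 2} (hz : F.IsCycle z) {v : V} {x : F.Position} (hx : x ∈ F.passages C v) :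
    F.crossing C z v = z x.inHalf.1 + z x.outHalf.1 :=
  HalfEdgeGraph.crossing_eq hC hF hz (by
    rw [transition_eq_image]; exact ⟨x, hx, rfl⟩)

open Classical in
-- Crossings at the positions strictly between `i` and `j` telescope; grouping them by vertex leaves
-- only those visited an odd number of times.
theorem IsEulerSystem.sum_interlaced_crossing [Fintype V] (hC : F.IsEulerSystem C)
    (hF : F.IsFourRegular) {z : E → ZMod 2} (hz : F.IsCycle z) {w : V} {γ : F.Circuit}
    (hγ : γ ∈ C) {i j : Fin (γ.n + 1)} (hij : i < j) (h : F.passages C w = {⟨γ, i⟩, ⟨γ, j⟩}) :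
    ∑ v, F.crossing C z v * (F.interlacementGraph C).adjMatrix (ZMod 2) v w =
      z (γ.half i).1 + z (γ.half (j - 1)).1 := by
  rw [← sum_Ioo_telescope (fun k => z (γ.half k).1) hij]
  have h1 : ∀ k ∈ Finset.Ioo i j, z (γ.half (k - 1)).1 + z (γ.half k).1 =
      F.crossing C z (F.vert (γ.half k)) := fun k _ =>
    (Position.crossing_eq hC.isCircuitPartition hF hz (x := ⟨γ, k⟩) ⟨hγ, rfl⟩).symm
  rw [Finset.sum_congr rfl h1,
    ← Finset.sum_fiberwise (Finset.Ioo i j) (fun k => F.vert (γ.half k))]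
  refine Finset.sum_congr rfl fun v _ => ?_
  rw [Finset.sum_congr rfl (g := fun _ => F.crossing C z v)
    (fun k hk => by rw [(Finset.mem_filter.1 hk).2]), Finset.sum_const, nsmul_eq_mul,
    hC.cast_card_visits_between hF hγ hij h v, SimpleGraph.adjMatrix_apply, mul_comm]

theorem IsEulerSystem.crossing_eq_vecMul [Fintype V] (hC : F.IsEulerSystem C)
    (hF : F.IsFourRegular) {P : Set F.Circuit} (hP : F.IsCircuitPartition P) {z : E → ZMod 2}
    (hz : F.IsCycle z) :
    F.crossing P z = Matrix.vecMul (F.crossing C z) (F.modifiedInterlacement C P) := by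
  classical
  have hCp := hC.isCircuitPartition
  ext w
  obtain ⟨γ, hγ, i, j, hij, h⟩ := hC.exists_visits hF w
  have hsum := hC.sum_interlaced_crossing hF hz hγ hij h
  have hx : (⟨γ, i⟩ : F.Position) ∈ F.passages C w := by simp [h]
  have hy : (⟨γ, j⟩ : F.Position) ∈ F.passages C w := by simp [h]
  have hφ := Position.crossing_eq hCp hF hz hy
  obtain ⟨x, hxe⟩ : ∃ x : F.Position, ⟨γ, i⟩ = x := ⟨_, rfl⟩
  obtain ⟨y, hye⟩ : ∃ y : F.Position, ⟨γ, j⟩ = y := ⟨_, rfl⟩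
  rw [hxe, hye] at h
  rw [hxe] at hx
  rw [hye] at hy hφ
  -- The $\chi$ transition pairs the arrival of the second visit with the departure of the first.
  have hsum' : ∑ v, F.crossing C z v * (F.interlacementGraph C).adjMatrix (ZMod 2) v w =
      z y.inHalf.1 + z x.outHalf.1 := by
    rw [hsum, ← hxe, ← hye, add_comm]; rfl
  have hxy : x ≠ y := by
    rw [← hxe, ← hye]
    intro e
    exact hij.ne (eq_of_heq (Sigma.mk.inj_iff.1 e).2)
  have h1 := hCp.inHalf_ne_outHalf hx.1 hx.1
  have h2 := hCp.inHalf_ne_outHalf hx.1 hy.1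
  have h3 := hCp.inHalf_ne_outHalf hy.1 hx.1
  have h4 := hCp.inHalf_ne_outHalf hy.1 hy.1
  have h5 : x.inHalf ≠ y.inHalf := fun e => hxy (hCp.inHalf_injOn w hx hy e)
  have h6 : x.outHalf ≠ y.outHalf := fun e => hxy (hCp.outHalf_injOn w hx hy e)
  have hT : F.transition C w = {s(x.inHalf, x.outHalf), s(y.inHalf, y.outHalf)} := by
    rw [transition_eq_image, h]; simp [Set.image_insert_eq]
  have hd : [x.inHalf, x.outHalf, y.inHalf, y.outHalf].Nodup := by
    simp [h1, h2, h3.symm, h4, h5, h6]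
  have hH : {h | F.vert h = w} = {x.inHalf, x.outHalf, y.inHalf, y.outHalf} := by
    rw [hCp.halfEdges_eq, h]
    ext h; simp; tauto
  have hcol : Matrix.vecMul (F.crossing C z) (F.modifiedInterlacement C P) w =
      ∑ v, F.crossing C z v * (if F.InvolvesPhi C P w then (if v = w then 1 else 0)
        else if F.InvolvesPsi C P w ∧ v = w then 1
        else (F.interlacementGraph C).adjMatrix (ZMod 2) v w) := rfl
  rw [hcol]
  obtain ⟨p, q, r, s, hd', hH', hT'⟩ := hP.exists_matching hF w
  rcases matching_cases hd hd' (hH.symm.trans hH') with e | e | e <;> rw [e] at hT'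
  · have hphi : F.InvolvesPhi C P w := hT'.trans hT.symm
    rw [crossing_eq hP hF hz (a := y.inHalf) (b := y.outHalf) (by simp [hT']), ← hφ]
    simp [hphi]
  · have hphi : ¬ F.InvolvesPhi C P w := by
      unfold InvolvesPhi
      rw [hT', hT, Set.pair_eq_pair_iff]
      simp only [Sym2.eq_iff]
      tauto
    have hpsi : ¬ F.InvolvesPsi C P w := by
      rintro ⟨-, hc⟩
      apply hc
      rw [hT']
      rintro _ (rfl | rfl)
      · exact ⟨_, _, rfl, x.isIncoming hx.1, y.isOutgoing hy.1⟩
      · exact ⟨_, _, rfl, y.isIncoming hy.1, x.isOutgoing hx.1⟩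
    rw [crossing_eq hP hF hz (a := y.inHalf) (b := x.outHalf) (by simp [hT']), ← hsum']
    simp only [if_neg hphi, hpsi, false_and, if_false]
  · have hphi : ¬ F.InvolvesPhi C P w := by
      unfold InvolvesPhi
      rw [hT', hT, Set.pair_eq_pair_iff]
      simp only [Sym2.eq_iff]
      tauto
    have hpsi : F.InvolvesPsi C P w := by
      refine ⟨hphi, fun hc => ?_⟩
      obtain ⟨a, b, hab, -, hb⟩ := hc s(x.inHalf, y.inHalf) (by simp [hT'])
      rcases Sym2.eq_iff.1 hab with ⟨rfl, rfl⟩ | ⟨rfl, rfl⟩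
      · exact hCp.not_incoming_of_outgoing hb (y.isIncoming hy.1)
      · exact hCp.not_incoming_of_outgoing hb (x.isIncoming hx.1)
    rw [crossing_eq hP hF hz (a := x.outHalf) (b := y.outHalf) (by simp [hT'])]
    -- The adjacency matrix has zero diagonal, so the diagonal 1 of a $\psi$ column adds the $\phi$
    -- contribution to the $\chi$ one.
    have hsplit : ∀ v, F.crossing C z v * (if F.InvolvesPhi C P w then (if v = w then 1 else 0)
        else if F.InvolvesPsi C P w ∧ v = w then 1
        else (F.interlacementGraph C).adjMatrix (ZMod 2) v w) =
        F.crossing C z v * (F.interlacementGraph C).adjMatrix (ZMod 2) v w +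
          if v = w then F.crossing C z v else 0 := by
      intro v
      by_cases hv : v = w
      · subst hv
        simp [hphi, hpsi]
      · simp [hphi, hv]
    rw [Finset.sum_congr rfl fun v _ => hsplit v, Finset.sum_add_distrib, hsum',
      Finset.sum_ite_eq' Finset.univ w, if_pos (Finset.mem_univ w), hφ]
    linear_combination -CharTwo.add_self_eq_zero (z y.inHalf.1)

/-! ### Cycles realizing the unit vectors -/

theorem IsCircuitPartition.isCycle_of_passages (hC : F.IsCircuitPartition C)
    (hF : F.IsFourRegular) {z : E → ZMod 2}
    (hz : ∀ v, ∀ x ∈ F.passages C v, ∀ y ∈ F.passages C v,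
      z x.inHalf.1 + z x.outHalf.1 = z y.inHalf.1 + z y.outHalf.1) : F.IsCycle z := by
  intro v
  obtain ⟨x, y, hxy, h⟩ := Set.ncard_eq_two.1 (hC.ncard_passages hF v)
  have hx : x ∈ F.passages C v := by simp [h]
  have hy : y ∈ F.passages C v := by simp [h]
  have h1 := hC.inHalf_ne_outHalf hx.1 hx.1
  have h2 := hC.inHalf_ne_outHalf hx.1 hy.1
  have h3 := hC.inHalf_ne_outHalf hy.1 hx.1
  have h4 := hC.inHalf_ne_outHalf hy.1 hy.1
  have h5 : x.inHalf ≠ y.inHalf := fun e => hxy (hC.inHalf_injOn v hx hy e)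
  have h6 : x.outHalf ≠ y.outHalf := fun e => hxy (hC.outHalf_injOn v hx hy e)
  have hd : [x.inHalf, x.outHalf, y.inHalf, y.outHalf].Nodup := by
    simp [h1, h2, h3.symm, h4, h5, h6]
  have hH : {h | F.vert h = v} = {x.inHalf, x.outHalf, y.inHalf, y.outHalf} := by
    rw [hC.halfEdges_eq, h]
    ext h; simp; tauto
  rw [sum_halfEdges hd hH]
  linear_combination hz v x hx y hy + CharTwo.add_self_eq_zero (z y.inHalf.1 + z y.outHalf.1)

/-- For `k = 0` the subtraction wraps to the last index, and both sides are false. -/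
theorem fin_sub_one_mem_Ico {n : ℕ} {i j k : Fin (n + 1)} :
    k - 1 ∈ Set.Ico i j ↔ i < k ∧ k ≤ j := by
  rcases eq_or_ne k 0 with rfl | hk
  · simp only [Set.mem_Ico, Fin.le_def, Fin.lt_def, zero_sub, Fin.coe_neg_one] at *
    simp; omega
  · have := Fin.val_sub_one_of_ne_zero hk
    have hk0 : k.val ≠ 0 := fun e => hk (Fin.ext e)
    simp only [Set.mem_Ico, Fin.le_def, Fin.lt_def] at *
    omega

theorem IsEulerSystem.exists_dual_cycle [DecidableEq V] (hC : F.IsEulerSystem C)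
    (hF : F.IsFourRegular) (v : V) :
    ∃ z, F.IsCycle z ∧ F.crossing C z = Pi.single v 1 := by
  classical
  have hCp := hC.isCircuitPartition
  obtain ⟨γ, hγ, i, j, hij, h⟩ := hC.exists_visits hF v
  -- The segment of `γ` from one visit of `v` to the next: its indicator changes value only at the
  -- passages `i` and `j`, both at `v`.
  let z : E → ZMod 2 := fun e => if ∃ k ∈ Set.Ico i j, (γ.half k).1 = e then 1 else 0
  have hzγ : ∀ k, z (γ.half k).1 = if k ∈ Set.Ico i j then 1 else 0 := by
    intro k
    refine if_congr ⟨?_, fun hk => ⟨k, hk, rfl⟩⟩ rfl rfl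
    rintro ⟨l, hl, e⟩
    rwa [← γ.edges_distinct e]
  have hzδ : ∀ δ ∈ C, δ ≠ γ → ∀ k, z (δ.half k).1 = 0 := by
    intro δ hδ hne k
    refine if_neg ?_
    rintro ⟨l, -, e⟩
    have := hCp.position_eq (x := ⟨γ, l⟩) (y := ⟨δ, k⟩) hγ hδ e
    exact hne (Sigma.mk.inj_iff.1 this).1.symm
  have hval : ∀ u, ∀ x ∈ F.passages C u,
      z x.inHalf.1 + z x.outHalf.1 = (Pi.single v 1 : V → ZMod 2) u := by
    rintro u ⟨δ, k⟩ hx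
    show z (δ.half (k - 1)).1 + z (δ.half k).1 = _
    by_cases hδ : δ = γ
    · subst hδ
      simp only [hzγ, fin_sub_one_mem_Ico]
      have hk : u = v ↔ k = i ∨ k = j := by
        constructor
        · rintro rfl
          rw [h] at hx
          simpa using hx
        · intro hk
          have hx' : (⟨δ, k⟩ : F.Position) ∈ F.passages C v := by
            rw [h]; rcases hk with rfl | rfl <;> simp
          exact hx.2.symm.trans hx'.2
      rw [Pi.single_apply, zmod_two_add_eq_ite]
      refine if_congr ?_ rfl rfl
      simp only [hk, Set.mem_Ico]
      by_cases h1 : i < k ∧ k ≤ j <;> by_cases h2 : i ≤ k ∧ k < j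
      · simp [h1, h2]; omega
      · simp [h1, h2]; omega
      · simp [h1, h2]; omega
      · simp [h1, h2]; omega
    · rw [hzδ δ hx.1 hδ, hzδ δ hx.1 hδ, add_zero, Pi.single_apply, if_neg]
      rintro rfl
      rw [h] at hx
      rcases hx with e | e <;> exact hδ (Sigma.mk.inj_iff.1 e).1
  have hz : F.IsCycle z := hCp.isCycle_of_passages hF fun u x hx y hy =>
    (hval u x hx).trans (hval u y hy).symm
  refine ⟨z, hz, funext fun u => ?_⟩
  obtain ⟨x, y, -, hu⟩ := Set.ncard_eq_two.1 (hCp.ncard_passages hF u)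
  have hx : x ∈ F.passages C u := by simp [hu]
  rw [Position.crossing_eq hCp hF hz hx, hval u x hx]

end Euler

/-! ### Product formula and nonsingularity -/

theorem modifiedInterlacement_self [DecidableEq V] (C : Set F.Circuit) :
    F.modifiedInterlacement C C = 1 := by
  ext w v
  simp [modifiedInterlacement, InvolvesPhi, Matrix.one_apply]

theorem modifiedInterlacement_eq_mul [Fintype V] {C C' P : Set F.Circuit}
    (hF : F.IsFourRegular) (hC : F.IsEulerSystem C) (hC' : F.IsEulerSystem C')
    (hP : F.IsCircuitPartition P) :
    F.modifiedInterlacement C' P =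
      F.modifiedInterlacement C' C * F.modifiedInterlacement C P := by
  classical
  refine Matrix.ext_of_single_vecMul fun v => ?_
  obtain ⟨z, hz, hv⟩ := hC'.exists_dual_cycle hF v
  rw [← Matrix.vecMul_vecMul, ← hv, ← hC'.crossing_eq_vecMul hF hP hz,
    ← hC'.crossing_eq_vecMul hF hC.isCircuitPartition hz, ← hC.crossing_eq_vecMul hF hP hz]

end HalfEdgeGraph

theorem mainTheorem2 {V E : Type*} [Fintype V] [DecidableEq V] [Finite E]
    (F : HalfEdgeGraph V E) (hF : F.IsFourRegular)
    (C C' : Set F.Circuit) (hC : F.IsEulerSystem C) (hC' : F.IsEulerSystem C') :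
    IsUnit (F.modifiedInterlacement C' C) ∧
      ∀ P : Set F.Circuit, F.IsCircuitPartition P →
        F.modifiedInterlacement C' P =
          F.modifiedInterlacement C' C * F.modifiedInterlacement C P := by
  refine ⟨?_, fun P hP => HalfEdgeGraph.modifiedInterlacement_eq_mul hF hC hC' hP⟩
  -- With `P = C'` the product formula exhibits a right inverse, which suffices for a square matrix
  -- over a field.
  have h := HalfEdgeGraph.modifiedInterlacement_eq_mul hF hC hC' hC'.isCircuitPartition
  rw [HalfEdgeGraph.modifiedInterlacement_self] at h
  exact IsUnit.of_mul_eq_one _ h.symm
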